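/- Let $X\in\mathbb R^{n\times d}$ have columns of Euclidean norm $1$, let $y\in\mathbb R^n$ with $\|y\|_2=1$, and put $C=X^\top X$. For $S\subseteq[d]$ let $P_S$ be the orthogonal projection onto the span of the columns of $X$ indexed by $S$, let $f(S)=\|P_S y\|_2^2$ (the $R^2$ statistic), and let $C_S$ be the submatrix of $C$ with rows and columns indexed by $S$. For an integer $m$ let $\lambda_{\min}(C,m)$ and $\lambda_{\max}(C,m)$ be the smallest and the largest $m$-sparse eigenvalue of $C$, i.e. the minimum of $\lambda_{\min}(C_S)$ and the maximum of $\lambda_{\max}(C_S)$ over the nonempty $S\subseteq[d]$ with $|S|\le m$. For a set $S$ of available choices, $\mathrm{Greedy}(S,k)$ starts with $A=\emptyset$ and repeats $k$ times: add to $A$ an element $j\in S\setminus A$ that maximizes $f(A\cup\{j\})-f(A)$ (ties are broken by a fixed linear order on $[d]$, and the procedure stops early if $S\setminus A=\emptyset$). $\mathrm{DistributedGreedy}$ with sparsity $k$ and $l\ge1$ machines assigns each element of $[d]$ independently and uniformly at random to one of $l$ parts $A_1,\dots,A_l$, computes $G_j=\mathrm{Greedy}(A_j,k)$ for all $j$ and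 $G=\mathrm{Greedy}(\bigcup_j G_j,k)$, and returns a set $A_{dg}$ among $G,G_1,\dots,G_l$ with the largest value of $f$. Theorem. Let $A^\star$ maximize $f$ over all $S\subseteq[d]$ with $|S|\le k$. Then, with the expectation taken over the random partition, $$\mathbb E[f(A_{dg})]\;\ge\;\frac12\,\frac{\lambda_{\min}(C_{A^\star})}{\lambda_{\max}(C_{A^\star})}\left(1-e^{-\lambda_{\min}(C,2k)}\right)f(A^\star)\;\ge\;\frac12\,\frac{\lambda_{\min}(C,k)}{\lambda_{\max}(C,k)}\left(1-e^{-\lambda_{\min}(C,2k)}\right)f(A^\star).$$ (If $A^\star=\emptyset$, then $f(A^\star)=0$ and both bounds are read as $0$.) -/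

import Mathlib

open scoped BigOperators

noncomputable section

/-- The `j`-th column of the feature matrix, as a vector of Euclidean space. -/
def featureCol {n d : ℕ} (X : Matrix (Fin n) (Fin d) ℝ) (j : Fin d) : EuclideanSpace ℝ (Fin n) :=
  WithLp.toLp 2 (fun i => X i j)

/-- The set function `f(S) = ‖P_S y‖²`, where `P_S` is the orthogonal projection onto the span of
the columns of `X` indexed by `S`. -/
def rSquared {n d : ℕ} (X : Matrix (Fin n) (Fin d) ℝ) (y : EuclideanSpace ℝ (Fin n))
    (S : Finset (Fin d)) : ℝ :=
  ‖(Submodule.span ℝ (featureCol X '' (S : Set (Fin d)))).starProjection y‖ ^ 2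

/-- The covariance matrix `C = Xᵀ X`. -/
def covMatrix {n d : ℕ} (X : Matrix (Fin n) (Fin d) ℝ) : Matrix (Fin d) (Fin d) ℝ :=
  X.transpose * X

/-- The principal submatrix `C_S`, with rows and columns indexed by `S`. -/
def principalSub {d : ℕ} (C : Matrix (Fin d) (Fin d) ℝ) (S : Finset (Fin d)) :
    Matrix {x // x ∈ S} {x // x ∈ S} ℝ :=
  C.submatrix Subtype.val Subtype.val

/-- Smallest eigenvalue of a (symmetric) real matrix. -/
def minEig {ι : Type*} [Fintype ι] [DecidableEq ι] (M : Matrix ι ι ℝ) : ℝ :=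
  sInf (spectrum ℝ M)

/-- Largest eigenvalue of a (symmetric) real matrix. -/
def maxEig {ι : Type*} [Fintype ι] [DecidableEq ι] (M : Matrix ι ι ℝ) : ℝ :=
  sSup (spectrum ℝ M)

/-- Smallest `k`-sparse eigenvalue: the minimum of `λ_min(C_S)` over nonempty `S` with at most `k`
elements. -/
def sparseMinEig {d : ℕ} (C : Matrix (Fin d) (Fin d) ℝ) (k : ℕ) : ℝ :=
  sInf {r | ∃ S : Finset (Fin d), S.Nonempty ∧ S.card ≤ k ∧ r = minEig (principalSub C S)}

/-- Largest `k`-sparse eigenvalue: the maximum of `λ_max(C_S)` over nonempty `S` with at most `k`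
elements. -/
def sparseMaxEig {d : ℕ} (C : Matrix (Fin d) (Fin d) ℝ) (k : ℕ) : ℝ :=
  sSup {r | ∃ S : Finset (Fin d), S.Nonempty ∧ S.card ≤ k ∧ r = maxEig (principalSub C S)}

open Classical in
/-- The elements of `S \ A` whose marginal gain over `A` is maximal. -/
def bestCandidates {d : ℕ} (f : Finset (Fin d) → ℝ) (S A : Finset (Fin d)) : Finset (Fin d) :=
  (S \ A).filter fun j => ∀ i ∈ S \ A, f (insert i A) - f A ≤ f (insert j A) - f A

theorem bestCandidates_nonempty {d : ℕ} (f : Finset (Fin d) → ℝ) {S A : Finset (Fin d)}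
    (h : (S \ A).Nonempty) : (bestCandidates f S A).Nonempty := by
  obtain ⟨j, hj, hmax⟩ := Finset.exists_max_image (S \ A) (fun j => f (insert j A) - f A) h
  exact ⟨j, Finset.mem_filter.2 ⟨hj, hmax⟩⟩

/-- The greedy choice from `S \ A`: the maximizer of the marginal gain over `A`; ties are broken in
favour of the element that comes first in the order given by `τ`. -/
def greedyChoice {d : ℕ} (f : Finset (Fin d) → ℝ) (τ : Equiv.Perm (Fin d)) (S A : Finset (Fin d))
    (h : (S \ A).Nonempty) : Fin d :=
  τ.symm (((bestCandidates f S A).image τ).min' ((bestCandidates_nonempty f h).image τ))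

/-- One greedy iteration; nothing happens once the available choices are exhausted. -/
def greedyStep {d : ℕ} (f : Finset (Fin d) → ℝ) (τ : Equiv.Perm (Fin d)) (S A : Finset (Fin d)) :
    Finset (Fin d) :=
  if h : (S \ A).Nonempty then insert (greedyChoice f τ S A h) A else A

/-- `Greedy(S, k)`: `k` greedy iterations on the available choices `S`, starting from `∅`. -/
def greedy {d : ℕ} (f : Finset (Fin d) → ℝ) (τ : Equiv.Perm (Fin d)) (S : Finset (Fin d))
    (k : ℕ) : Finset (Fin d) :=
  (greedyStep f τ S)^[k] ∅

/-- The part `A_j` of the partition that assigns the feature `i` to the machine `φ i`. -/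
def part {d l : ℕ} (φ : Fin d → Fin l) (j : Fin l) : Finset (Fin d) :=
  Finset.univ.filter fun i => φ i = j

/-- The local solution `G_j = Greedy(A_j, k)`. -/
def localSolution {d l : ℕ} (f : Finset (Fin d) → ℝ) (τ : Equiv.Perm (Fin d)) (k : ℕ)
    (φ : Fin d → Fin l) (j : Fin l) : Finset (Fin d) :=
  greedy f τ (part φ j) k

/-- The aggregated solution `G = Greedy(⋃ j, G_j, k)`. -/
def aggregatedSolution {d l : ℕ} (f : Finset (Fin d) → ℝ) (τ : Equiv.Perm (Fin d)) (k : ℕ)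
    (φ : Fin d → Fin l) : Finset (Fin d) :=
  greedy f τ (Finset.univ.biUnion (localSolution f τ k φ)) k

/-- `A` is an output of `DistributedGreedy` on the partition given by `φ`: it is a best one among
the `l` local solutions and the aggregated solution. -/
def IsDistributedGreedyOutput {d l : ℕ} (f : Finset (Fin d) → ℝ) (τ : Equiv.Perm (Fin d)) (k : ℕ)
    (φ : Fin d → Fin l) (A : Finset (Fin d)) : Prop :=
  (A = aggregatedSolution f τ k φ ∨ ∃ j, A = localSolution f τ k φ j) ∧
    f (aggregatedSolution f τ k φ) ≤ f A ∧ ∀ j, f (localSolution f τ k φ j) ≤ f A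

/-- `A` is an optimal solution of `max_{|S| ≤ k} f(S)`. -/
def IsOptimalSupport {d : ℕ} (f : Finset (Fin d) → ℝ) (k : ℕ) (A : Finset (Fin d)) : Prop :=
  A.card ≤ k ∧ ∀ S : Finset (Fin d), S.card ≤ k → f S ≤ f A

end

/-! The function f is not submodular, so it is compared with the additive function g(S) = ∑_{j∈S}
⟨y, x_j⟩². On the optimum, λ_min(C_{A⋆}) f(A⋆) ≤ g(A⋆) (`minEig_mul_rSquared_le`), and g(S) ≤
λ_max(C_{A⋆}) f(S) for S ⊆ A⋆ (`sum_inner_sq_le_maxEig_mul_rSquared`).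

Fix a partition φ and a machine j. Let T₁ be the o ∈ A⋆ picked by their own machine, T₂ those not
picked when added to part j. Greedy achieves at least κ f(T), κ = 1 - exp(-λ_min(C,2k)), against any
T of at most k available elements (`rSquared_greedy_ge`). The aggregated run has T₁ available. The
local run on part j is unchanged when T₂ is added (`greedy_eq_of_forall_notMem`), so it competes
with T₂. Hence the output is at least κ f(T₁) and κ f(T₂).

For uniform φ and j, each o lies in T₁ and in T₂ with probabilities summing to 1
(`sum_insert_part_eq`). Additivity gives E g(T₁) + E g(T₂) = g(A⋆); the two bounds on the output
give the factor 1/2. -/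

theorem posSemidef_covMatrix {n d : ℕ} (X : Matrix (Fin n) (Fin d) ℝ) :
    (covMatrix X).PosSemidef := by
  have h := Matrix.posSemidef_conjTranspose_mul_self X
  rwa [Matrix.conjTranspose_eq_transpose_of_trivial] at h

theorem posSemidef_principalSub_covMatrix {n d : ℕ} (X : Matrix (Fin n) (Fin d) ℝ)
    (S : Finset (Fin d)) : (principalSub (covMatrix X) S).PosSemidef :=
  (posSemidef_covMatrix X).submatrix _

theorem covMatrix_apply_eq_inner {n d : ℕ} (X : Matrix (Fin n) (Fin d) ℝ) (i j : Fin d) :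
    covMatrix X i j = inner ℝ (featureCol X i) (featureCol X j) := by
  simp [covMatrix, featureCol, Matrix.mul_apply, PiLp.inner_apply, mul_comm]

theorem dotProduct_mulVec_principalSub_covMatrix {n d : ℕ} (X : Matrix (Fin n) (Fin d) ℝ)
    (S : Finset (Fin d)) (c : Fin d → ℝ) :
    (fun i : {x // x ∈ S} => c i) ⬝ᵥ
        (principalSub (covMatrix X) S).mulVec (fun i : {x // x ∈ S} => c i) =
      ‖∑ j ∈ S, c j • featureCol X j‖ ^ 2 := by
  rw [← real_inner_self_eq_norm_sq, sum_inner]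
  simp only [inner_sum, real_inner_smul_left, real_inner_smul_right, dotProduct, Matrix.mulVec,
    principalSub, Matrix.submatrix_apply, covMatrix_apply_eq_inner, Finset.mul_sum]
  rw [← Finset.sum_coe_sort S]
  refine Finset.sum_congr rfl fun i _ => ?_
  rw [← Finset.sum_coe_sort S]
  exact Finset.sum_congr rfl fun j _ => by ring

/-! ### Rayleigh quotient bounds -/

section Eigenvalues

variable {ι : Type*} [Fintype ι] [DecidableEq ι] {M : Matrix ι ι ℝ}

theorem minEig_mul_dotProduct_self_le (hM : M.IsHermitian) (c : ι → ℝ) :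
    minEig M * (c ⬝ᵥ c) ≤ c ⬝ᵥ M.mulVec c := by
  have h : (M - algebraMap ℝ _ (minEig M)).PosSemidef := by
    rw [Matrix.posSemidef_iff_isHermitian_and_spectrum_nonneg]
    refine ⟨hM.sub ?_, ?_⟩
    · rw [Matrix.algebraMap_eq_diagonal]
      exact Matrix.isHermitian_diagonal _
    · rw [← spectrum.sub_singleton_eq]
      rintro _ ⟨a, ha, _, rfl, rfl⟩
      exact sub_nonneg.2 (csInf_le M.finite_real_spectrum.bddBelow ha)
  have h' := h.dotProduct_mulVec_nonneg c
  simp only [star_trivial, Matrix.sub_mulVec, dotProduct_sub, Algebra.algebraMap_eq_smul_one,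
    Matrix.smul_mulVec, Matrix.one_mulVec, dotProduct_smul, smul_eq_mul] at h'
  linarith

theorem dotProduct_mulVec_le_maxEig_mul (hM : M.IsHermitian) (c : ι → ℝ) :
    c ⬝ᵥ M.mulVec c ≤ maxEig M * (c ⬝ᵥ c) := by
  have h : (algebraMap ℝ _ (maxEig M) - M).PosSemidef := by
    rw [Matrix.posSemidef_iff_isHermitian_and_spectrum_nonneg]
    refine ⟨Matrix.IsHermitian.sub ?_ hM, ?_⟩
    · rw [Matrix.algebraMap_eq_diagonal]
      exact Matrix.isHermitian_diagonal _
    · rw [← spectrum.singleton_sub_eq]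
      rintro _ ⟨_, rfl, a, ha, rfl⟩
      exact sub_nonneg.2 (le_csSup M.finite_real_spectrum.bddAbove ha)
  have h' := h.dotProduct_mulVec_nonneg c
  simp only [star_trivial, Matrix.sub_mulVec, dotProduct_sub, Algebra.algebraMap_eq_smul_one,
    Matrix.smul_mulVec, Matrix.one_mulVec, dotProduct_smul, smul_eq_mul] at h'
  linarith

theorem minEig_nonneg (hM : M.PosSemidef) : 0 ≤ minEig M :=
  Real.sInf_nonneg (Matrix.posSemidef_iff_isHermitian_and_spectrum_nonneg.1 hM).2

end Eigenvalues

/-! ### Eigenvalue bounds for column combinations -/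

section SparseEigenvalues

variable {n d : ℕ} (X : Matrix (Fin n) (Fin d) ℝ)

theorem minEig_mul_sum_sq_le (S : Finset (Fin d)) (c : Fin d → ℝ) :
    minEig (principalSub (covMatrix X) S) * ∑ j ∈ S, c j ^ 2 ≤
      ‖∑ j ∈ S, c j • featureCol X j‖ ^ 2 := by
  have h := minEig_mul_dotProduct_self_le (posSemidef_principalSub_covMatrix X S).1
    (fun i => c i)
  rw [dotProduct_mulVec_principalSub_covMatrix] at h
  simpa only [dotProduct, ← pow_two, Finset.sum_coe_sort S fun j => c j ^ 2] using h

theorem norm_sum_sq_le_maxEig_mul (S : Finset (Fin d)) (c : Fin d → ℝ) :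
    ‖∑ j ∈ S, c j • featureCol X j‖ ^ 2 ≤
      maxEig (principalSub (covMatrix X) S) * ∑ j ∈ S, c j ^ 2 := by
  have h := dotProduct_mulVec_le_maxEig_mul (posSemidef_principalSub_covMatrix X S).1
    (fun i => c i)
  rw [dotProduct_mulVec_principalSub_covMatrix] at h
  simpa only [dotProduct, ← pow_two, Finset.sum_coe_sort S fun j => c j ^ 2] using h

theorem one_le_maxEig (hX : ∀ j, ‖featureCol X j‖ = 1) {S : Finset (Fin d)} (hS : S.Nonempty) :
    1 ≤ maxEig (principalSub (covMatrix X) S) := by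
  obtain ⟨i, hi⟩ := hS
  -- A coordinate vector has Rayleigh quotient 1, as columns are unit vectors.
  have h := norm_sum_sq_le_maxEig_mul X S (Pi.single i 1)
  simpa [Pi.single_apply, hi, hX] using h

theorem minEig_le_one (hX : ∀ j, ‖featureCol X j‖ = 1) {S : Finset (Fin d)} (hS : S.Nonempty) :
    minEig (principalSub (covMatrix X) S) ≤ 1 := by
  obtain ⟨i, hi⟩ := hS
  have h := minEig_mul_sum_sq_le X S (Pi.single i 1)
  simpa [Pi.single_apply, hi, hX] using h

theorem sparseMinEig_nonneg (k : ℕ) : 0 ≤ sparseMinEig (covMatrix X) k := by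
  refine Real.sInf_nonneg ?_
  rintro _ ⟨S, -, -, rfl⟩
  exact minEig_nonneg (posSemidef_principalSub_covMatrix X S)

theorem sparseMinEig_le_minEig {k : ℕ} {S : Finset (Fin d)} (hS : S.Nonempty)
    (hk : S.card ≤ k) : sparseMinEig (covMatrix X) k ≤ minEig (principalSub (covMatrix X) S) := by
  refine csInf_le ⟨0, ?_⟩ ⟨S, hS, hk, rfl⟩
  rintro _ ⟨S, -, -, rfl⟩
  exact minEig_nonneg (posSemidef_principalSub_covMatrix X S)

theorem maxEig_le_sparseMaxEig {k : ℕ} {S : Finset (Fin d)} (hS : S.Nonempty)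
    (hk : S.card ≤ k) : maxEig (principalSub (covMatrix X) S) ≤ sparseMaxEig (covMatrix X) k := by
  refine le_csSup (Set.Finite.bddAbove ?_) ⟨S, hS, hk, rfl⟩
  refine (Set.finite_range fun S => maxEig (principalSub (covMatrix X) S)).subset ?_
  rintro _ ⟨S, -, -, rfl⟩
  exact ⟨S, rfl⟩

end SparseEigenvalues

/-! ### Gains in R² versus squared correlations -/

section RSquared

variable {n d : ℕ} (X : Matrix (Fin n) (Fin d) ℝ) (y : EuclideanSpace ℝ (Fin n))

/-- The orthogonal projection `P_S y` of `y` onto the span of the columns indexed by `S`. -/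
noncomputable def fitted (S : Finset (Fin d)) : EuclideanSpace ℝ (Fin n) :=
  (Submodule.span ℝ (featureCol X '' (S : Set (Fin d)))).starProjection y

theorem fitted_mem (S : Finset (Fin d)) :
    fitted X y S ∈ Submodule.span ℝ (featureCol X '' (S : Set (Fin d))) :=
  Submodule.starProjection_apply_mem _ _

theorem inner_fitted_left {S : Finset (Fin d)} {w : EuclideanSpace ℝ (Fin n)}
    (hw : w ∈ Submodule.span ℝ (featureCol X '' (S : Set (Fin d)))) :
    inner ℝ (fitted X y S) w = inner ℝ y w := by
  have h := Submodule.starProjection_inner_eq_zero y w hw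
  rw [inner_sub_left, sub_eq_zero] at h
  exact h.symm

theorem featureCol_mem_span {S : Finset (Fin d)} {j : Fin d} (hj : j ∈ S) :
    featureCol X j ∈ Submodule.span ℝ (featureCol X '' (S : Set (Fin d))) :=
  Submodule.subset_span ⟨j, hj, rfl⟩

theorem rSquared_nonneg (S : Finset (Fin d)) : 0 ≤ rSquared X y S := sq_nonneg _

theorem rSquared_empty : rSquared X y ∅ = 0 := by
  have h := fitted_mem X y ∅
  simp only [Finset.coe_empty, Set.image_empty, Submodule.span_empty, Submodule.mem_bot] at h
  change ‖fitted X y ∅‖ ^ 2 = 0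
  simp [h]

theorem rSquared_sub_eq_norm_sq {A B : Finset (Fin d)} (h : A ⊆ B) :
    rSquared X y B - rSquared X y A = ‖fitted X y B - fitted X y A‖ ^ 2 := by
  have hA : fitted X y A ∈ Submodule.span ℝ (featureCol X '' (B : Set (Fin d))) :=
    Submodule.span_mono (Set.image_mono (Finset.coe_subset.2 h)) (fitted_mem X y A)
  have h1 := inner_fitted_left X y hA
  have h2 := inner_fitted_left X y (fitted_mem X y A)
  rw [norm_sub_sq_real, h1, ← h2, real_inner_self_eq_norm_sq]
  change ‖fitted X y B‖ ^ 2 - ‖fitted X y A‖ ^ 2 = _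
  ring

theorem rSquared_mono {A B : Finset (Fin d)} (h : A ⊆ B) : rSquared X y A ≤ rSquared X y B := by
  have := rSquared_sub_eq_norm_sq X y h
  nlinarith [sq_nonneg ‖fitted X y B - fitted X y A‖]

/-- The increment of the projection has the same inner product with x_j as the residual;
Cauchy–Schwarz with ‖x_j‖ = 1 finishes. -/
theorem inner_sub_fitted_sq_le_gain (hX : ∀ j, ‖featureCol X j‖ = 1) (A : Finset (Fin d))
    (j : Fin d) :
    inner ℝ (y - fitted X y A) (featureCol X j) ^ 2 ≤
      rSquared X y (insert j A) - rSquared X y A := by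
  have h1 : inner ℝ (fitted X y (insert j A) - fitted X y A) (featureCol X j) =
      inner ℝ (y - fitted X y A) (featureCol X j) := by
    rw [inner_sub_left, inner_sub_left,
      inner_fitted_left X y (featureCol_mem_span X (Finset.mem_insert_self j A))]
  have h2 := abs_real_inner_le_norm (fitted X y (insert j A) - fitted X y A) (featureCol X j)
  rw [hX, mul_one, h1] at h2
  rw [rSquared_sub_eq_norm_sq X y (Finset.subset_insert j A), ← sq_abs]
  exact pow_le_pow_left₀ (abs_nonneg _) h2 2

/-- The increment w = ∑ c_j x_j has ‖w‖² = ⟨residual, w⟩, where only j ∈ T \ A contribute since the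
residual is orthogonal to the columns in A. Cauchy–Schwarz and m ∑ c_j² ≤ ‖w‖² give the bound. -/
theorem minEig_mul_rSquared_union_sub_le (A T : Finset (Fin d)) :
    minEig (principalSub (covMatrix X) (A ∪ T)) * (rSquared X y (A ∪ T) - rSquared X y A) ≤
      ∑ j ∈ T \ A, inner ℝ (y - fitted X y A) (featureCol X j) ^ 2 := by
  classical
  set w := fitted X y (A ∪ T) - fitted X y A with hw
  have hwmem : w ∈ Submodule.span ℝ (featureCol X '' ((A ∪ T : Finset (Fin d)) : Set (Fin d))) :=
    Submodule.sub_mem _ (fitted_mem X y _) (Submodule.span_mono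
      (Set.image_mono (Finset.coe_subset.2 Finset.subset_union_left)) (fitted_mem X y A))
  obtain ⟨c, hc⟩ := (Submodule.mem_span_image_finset_iff_exists_fun' ℝ).1 hwmem
  set B := ∑ j ∈ T \ A, inner ℝ (y - fitted X y A) (featureCol X j) ^ 2
  set m := minEig (principalSub (covMatrix X) (A ∪ T))
  have hm : 0 ≤ m := minEig_nonneg (posSemidef_principalSub_covMatrix X _)
  have h1 : ‖w‖ ^ 2 = inner ℝ (y - fitted X y A) w := by
    rw [← real_inner_self_eq_norm_sq]
    conv_lhs => rw [hw]
    rw [← hw, inner_sub_left, inner_sub_left, inner_fitted_left X y hwmem]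
  have h2 : ‖w‖ ^ 2 = ∑ j ∈ T \ A, c j * inner ℝ (y - fitted X y A) (featureCol X j) := by
    rw [h1, ← hc, inner_sum]
    simp only [real_inner_smul_right]
    symm
    refine Finset.sum_subset (fun j hj => ?_) fun j hj hj' => ?_
    · exact Finset.mem_union_right _ (Finset.mem_sdiff.1 hj).1
    · have hjA : j ∈ A := by
        simp only [Finset.mem_sdiff, Finset.mem_union] at hj hj'
        tauto
      rw [inner_sub_left, inner_fitted_left X y (featureCol_mem_span X hjA), sub_self, mul_zero]
  have h3 : (‖w‖ ^ 2) ^ 2 ≤ (∑ j ∈ T \ A, c j ^ 2) * B := by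
    rw [h2]
    exact Finset.sum_mul_sq_le_sq_mul_sq _ _ _
  have h4 : ∑ j ∈ T \ A, c j ^ 2 ≤ ∑ j ∈ A ∪ T, c j ^ 2 :=
    Finset.sum_le_sum_of_subset_of_nonneg
      (fun j hj => Finset.mem_union_right _ (Finset.mem_sdiff.1 hj).1) fun _ _ _ => sq_nonneg _
  have h5 := minEig_mul_sum_sq_le X (A ∪ T) c
  rw [hc] at h5
  have hB : 0 ≤ B := Finset.sum_nonneg fun _ _ => sq_nonneg _
  rw [rSquared_sub_eq_norm_sq X y Finset.subset_union_left, ← hw]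
  rcases (sq_nonneg ‖w‖).eq_or_lt with h0 | h0
  · rw [← h0, mul_zero]
    exact hB
  · refine le_of_mul_le_mul_right ?_ h0
    calc m * ‖w‖ ^ 2 * ‖w‖ ^ 2 = m * (‖w‖ ^ 2) ^ 2 := by ring
      _ ≤ m * ((∑ j ∈ T \ A, c j ^ 2) * B) := mul_le_mul_of_nonneg_left h3 hm
      _ = (m * ∑ j ∈ T \ A, c j ^ 2) * B := by ring
      _ ≤ (m * ∑ j ∈ A ∪ T, c j ^ 2) * B := by gcongr
      _ ≤ ‖w‖ ^ 2 * B := by gcongr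
      _ = B * ‖w‖ ^ 2 := mul_comm _ _

theorem minEig_mul_rSquared_le (S : Finset (Fin d)) :
    minEig (principalSub (covMatrix X) S) * rSquared X y S ≤
      ∑ j ∈ S, inner ℝ y (featureCol X j) ^ 2 := by
  have h := minEig_mul_rSquared_union_sub_le X y ∅ S
  have h0 : fitted X y ∅ = 0 := by
    have h := rSquared_empty X y
    exact norm_eq_zero.1 (pow_eq_zero_iff two_ne_zero |>.1 h)
  rwa [Finset.empty_union, Finset.sdiff_empty, rSquared_empty, sub_zero, h0, sub_zero] at h

/-- Test P_S y against w = ∑_{j∈S} ⟨y, x_j⟩ x_j. The larger set T lets one constant serve all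
subsets of A⋆. -/
theorem sum_inner_sq_le_maxEig_mul_rSquared {S T : Finset (Fin d)} (h : S ⊆ T) :
    ∑ j ∈ S, inner ℝ y (featureCol X j) ^ 2 ≤
      maxEig (principalSub (covMatrix X) T) * rSquared X y S := by
  classical
  set b : Fin d → ℝ := fun j => inner ℝ y (featureCol X j) with hb
  set w := ∑ j ∈ S, b j • featureCol X j with hw
  have hwmem : w ∈ Submodule.span ℝ (featureCol X '' (S : Set (Fin d))) :=
    Submodule.sum_mem _ fun j hj => Submodule.smul_mem _ _ (featureCol_mem_span X hj)
  have h1 : ∑ j ∈ S, b j ^ 2 = inner ℝ (fitted X y S) w := by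
    rw [inner_fitted_left X y hwmem, hw, inner_sum]
    exact Finset.sum_congr rfl fun j _ => by rw [real_inner_smul_right, pow_two]
  have h2 : ‖w‖ ^ 2 ≤ maxEig (principalSub (covMatrix X) T) * ∑ j ∈ S, b j ^ 2 := by
    -- Extending the coefficients by zero allows C_T in place of C_S.
    have := norm_sum_sq_le_maxEig_mul X T (fun j => if j ∈ S then b j else 0)
    simpa only [ite_smul, zero_smul, ite_pow, zero_pow two_ne_zero, Finset.sum_ite_mem,
      Finset.inter_eq_right.2 h] using this
  have h3 : (∑ j ∈ S, b j ^ 2) ^ 2 ≤ rSquared X y S * ‖w‖ ^ 2 := by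
    rw [h1, ← sq_abs]
    change _ ≤ ‖fitted X y S‖ ^ 2 * ‖w‖ ^ 2
    rw [← mul_pow]
    exact pow_le_pow_left₀ (abs_nonneg _) (abs_real_inner_le_norm _ _) 2
  have hf := rSquared_nonneg X y S
  rcases (Finset.sum_nonneg fun j _ => sq_nonneg (b j) : 0 ≤ ∑ j ∈ S, b j ^ 2).eq_or_lt
    with h0 | h0
  · rw [← h0]
    exact mul_nonneg (Real.sSup_nonneg
      (Matrix.posSemidef_iff_isHermitian_and_spectrum_nonneg.1
        (posSemidef_principalSub_covMatrix X T)).2) hf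
  · refine le_of_mul_le_mul_right ?_ h0
    nlinarith [mul_le_mul_of_nonneg_left h2 hf]

end RSquared

/-! ### Stability of greedy under adding rejected elements -/

section Greedy

variable {d : ℕ} (f : Finset (Fin d) → ℝ) (τ : Equiv.Perm (Fin d))

/-- `c` is at least as good a greedy choice as `i`, given the current set `A`. -/
def GreedyBeats (A : Finset (Fin d)) (c i : Fin d) : Prop :=
  f (insert i A) - f A ≤ f (insert c A) - f A ∧
    (f (insert i A) - f A = f (insert c A) - f A → τ c ≤ τ i)

variable {f τ}

/-- The fixed tie-breaking order makes the best candidate unique, so runs on different sets can be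
compared. -/
theorem GreedyBeats.antisymm {A : Finset (Fin d)} {c i : Fin d} (h : GreedyBeats f τ A c i)
    (h' : GreedyBeats f τ A i c) : c = i := by
  have he := le_antisymm h.1 h'.1
  exact τ.injective (le_antisymm (h.2 he) (h'.2 he.symm))

theorem greedyChoice_mem_bestCandidates {S A : Finset (Fin d)} (h : (S \ A).Nonempty) :
    greedyChoice f τ S A h ∈ bestCandidates f S A := by
  have := Finset.min'_mem ((bestCandidates f S A).image τ) ((bestCandidates_nonempty f h).image τ)
  obtain ⟨c, hc, hc'⟩ := Finset.mem_image.1 this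
  rw [greedyChoice, ← hc', Equiv.symm_apply_apply]
  exact hc

theorem greedyChoice_mem {S A : Finset (Fin d)} (h : (S \ A).Nonempty) :
    greedyChoice f τ S A h ∈ S \ A :=
  (Finset.mem_filter.1 (greedyChoice_mem_bestCandidates h)).1

theorem greedyChoice_beats {S A : Finset (Fin d)} (h : (S \ A).Nonempty) {i : Fin d}
    (hi : i ∈ S \ A) : GreedyBeats f τ A (greedyChoice f τ S A h) i := by
  have hc := (Finset.mem_filter.1 (greedyChoice_mem_bestCandidates (τ := τ) (f := f) h)).2
  refine ⟨hc i hi, fun he => ?_⟩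
  have hi' : i ∈ bestCandidates f S A :=
    Finset.mem_filter.2 ⟨hi, fun j hj => (hc j hj).trans he.ge⟩
  rw [greedyChoice, Equiv.apply_symm_apply]
  exact Finset.min'_le _ _ (Finset.mem_image_of_mem _ hi')

theorem greedyChoice_eq {S A : Finset (Fin d)} (h : (S \ A).Nonempty) {c : Fin d}
    (hc : c ∈ S \ A) (hbeats : ∀ i ∈ S \ A, GreedyBeats f τ A c i) :
    greedyChoice f τ S A h = c :=
  (greedyChoice_beats h hc).antisymm (hbeats _ (greedyChoice_mem h))

theorem greedy_succ (S : Finset (Fin d)) (k : ℕ) :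
    greedy f τ S (k + 1) = greedyStep f τ S (greedy f τ S k) :=
  Function.iterate_succ_apply' _ _ _

theorem subset_greedyStep (S A : Finset (Fin d)) : A ⊆ greedyStep f τ S A := by
  unfold greedyStep
  split_ifs
  · exact Finset.subset_insert _ _
  · exact subset_rfl

theorem card_greedy_le (S : Finset (Fin d)) (k : ℕ) : (greedy f τ S k).card ≤ k := by
  induction k with
  | zero => simp [greedy]
  | succ k ih =>
    rw [greedy_succ, greedyStep]
    split_ifs
    · exact (Finset.card_insert_le _ _).trans (by omega)
    · omega

/-- Adding available choices that are not picked when added one at a time does not change the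
greedy step. -/
theorem greedyStep_eq_of_forall_notMem {R S A : Finset (Fin d)} (hRS : R ⊆ S)
    (h : ∀ o ∈ S \ R, o ∉ greedyStep f τ (insert o R) A) :
    greedyStep f τ S A = greedyStep f τ R A ∧
      ∀ o ∈ S \ R, greedyStep f τ (insert o R) A = greedyStep f τ R A := by
  have hA : ∀ o ∈ S \ R, o ∉ A := fun o ho hoA => h o ho (subset_greedyStep _ _ hoA)
  have hne : ∀ o ∈ S \ R, (insert o R \ A).Nonempty := fun o ho =>
    ⟨o, Finset.mem_sdiff.2 ⟨Finset.mem_insert_self _ _, hA o ho⟩⟩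
  have hc : ∀ o (ho : o ∈ S \ R), greedyChoice f τ (insert o R) A (hne o ho) ∈ R \ A := by
    intro o ho
    have h1 := greedyChoice_mem (f := f) (τ := τ) (hne o ho)
    have h2 := h o ho
    rw [greedyStep, dif_pos (hne o ho), Finset.mem_insert, not_or] at h2
    rw [Finset.mem_sdiff, Finset.mem_insert] at h1
    exact Finset.mem_sdiff.2 ⟨h1.1.resolve_left (Ne.symm h2.1), h1.2⟩
  by_cases hR : (R \ A).Nonempty
  · set c := greedyChoice f τ R A hR
    have hcR : c ∈ R \ A := greedyChoice_mem hR
    have key : ∀ o (ho : o ∈ S \ R), greedyChoice f τ (insert o R) A (hne o ho) = c := by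
      intro o ho
      refine GreedyBeats.antisymm (f := f) (τ := τ) (A := A)
        (greedyChoice_beats _ ?_) (greedyChoice_beats hR (hc o ho))
      exact Finset.sdiff_subset_sdiff (Finset.subset_insert _ _) subset_rfl hcR
    refine ⟨?_, fun o ho => ?_⟩
    · have hS : (S \ A).Nonempty := hR.mono (Finset.sdiff_subset_sdiff hRS subset_rfl)
      rw [greedyStep, greedyStep, dif_pos hS, dif_pos hR]
      congr 1
      refine greedyChoice_eq hS (Finset.sdiff_subset_sdiff hRS subset_rfl hcR) fun i hi => ?_
      rw [Finset.mem_sdiff] at hi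
      by_cases hiR : i ∈ R
      · exact greedyChoice_beats hR (Finset.mem_sdiff.2 ⟨hiR, hi.2⟩)
      · have ho : i ∈ S \ R := Finset.mem_sdiff.2 ⟨hi.1, hiR⟩
        have hb := greedyChoice_beats (f := f) (τ := τ) (hne i ho)
          (Finset.mem_sdiff.2 ⟨Finset.mem_insert_self i R, hi.2⟩)
        rwa [key i ho] at hb
    · rw [greedyStep, greedyStep, dif_pos (hne o ho), dif_pos hR, key o ho]
  -- With R exhausted, any added o would be picked; hence nothing is added.
  · have hSR : ∀ o, o ∉ S \ R := fun o ho => hR ⟨_, hc o ho⟩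
    have hS : S = R := subset_antisymm
      (Finset.sdiff_eq_empty_iff_subset.1 (Finset.eq_empty_of_forall_notMem hSR)) hRS
    exact ⟨by rw [hS], fun o ho => (hSR o ho).elim⟩

theorem greedy_eq_of_forall_notMem {R S : Finset (Fin d)} (hRS : R ⊆ S) (k : ℕ)
    (h : ∀ o ∈ S \ R, o ∉ greedy f τ (insert o R) k) :
    greedy f τ S k = greedy f τ R k ∧
      ∀ o ∈ S \ R, greedy f τ (insert o R) k = greedy f τ R k := by
  induction k with
  | zero => exact ⟨rfl, fun _ _ => rfl⟩
  | succ k ih =>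
    -- Greedy sets only grow, so an element rejected after k + 1 steps was rejected after k.
    obtain ⟨h1, h2⟩ := ih fun o ho hk => h o ho (by
      rw [greedy_succ]
      exact subset_greedyStep _ _ hk)
    have h3 : ∀ o ∈ S \ R, o ∉ greedyStep f τ (insert o R) (greedy f τ R k) := fun o ho => by
      rw [← h2 o ho, ← greedy_succ]
      exact h o ho
    obtain ⟨h4, h5⟩ := greedyStep_eq_of_forall_notMem hRS h3
    refine ⟨by rw [greedy_succ, greedy_succ, h1, h4], fun o ho => ?_⟩
    rw [greedy_succ, greedy_succ, h2 o ho, h5 o ho]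

end Greedy

/-! ### Approximation guarantee of greedy -/

section GreedyRSquared

variable {n d : ℕ} (X : Matrix (Fin n) (Fin d) ℝ) (y : EuclideanSpace ℝ (Fin n))
  (τ : Equiv.Perm (Fin d))

/-- The greedy gain dominates each of the at most k squared residual correlations over T \ A; the
sparsity 2k comes from |A ∪ T|. -/
theorem sparseMinEig_mul_sub_le_mul_gain (hX : ∀ j, ‖featureCol X j‖ = 1) {k : ℕ}
    {S T A : Finset (Fin d)} (hTS : T ⊆ S) (hT : T.card ≤ k) (hA : A.card ≤ k) :
    sparseMinEig (covMatrix X) (2 * k) * (rSquared X y T - rSquared X y A) ≤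
      k * (rSquared X y (greedyStep (rSquared X y) τ S A) - rSquared X y A) := by
  have hstep := sub_nonneg.2 (rSquared_mono X y
    (subset_greedyStep (f := rSquared X y) (τ := τ) S A))
  have hγ := sparseMinEig_nonneg X (2 * k)
  by_cases hTA : T ⊆ A
  · have h1 := rSquared_mono X y hTA
    have h2 : (0 : ℝ) ≤ k * (rSquared X y (greedyStep (rSquared X y) τ S A) - rSquared X y A) := by
      positivity
    nlinarith
  have hTA' : (T \ A).Nonempty := Finset.sdiff_nonempty.2 hTA
  have hne : (S \ A).Nonempty := hTA'.mono (Finset.sdiff_subset_sdiff hTS subset_rfl)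
  set g := rSquared X y (greedyStep (rSquared X y) τ S A) - rSquared X y A with hg
  have hgain : ∀ j ∈ T \ A, inner ℝ (y - fitted X y A) (featureCol X j) ^ 2 ≤ g := by
    intro j hj
    refine (inner_sub_fitted_sq_le_gain X y hX A j).trans ?_
    rw [hg, greedyStep, dif_pos hne]
    exact (greedyChoice_beats hne (Finset.sdiff_subset_sdiff hTS subset_rfl hj)).1
  have hne' : (A ∪ T).Nonempty := hTA'.mono (Finset.sdiff_subset.trans Finset.subset_union_right)
  have hcard : (A ∪ T).card ≤ 2 * k := (Finset.card_union_le A T).trans (by omega)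
  have hD := sub_nonneg.2 (rSquared_mono X y (Finset.subset_union_left (s₁ := A) (s₂ := T)))
  calc sparseMinEig (covMatrix X) (2 * k) * (rSquared X y T - rSquared X y A)
      ≤ sparseMinEig (covMatrix X) (2 * k) * (rSquared X y (A ∪ T) - rSquared X y A) := by
        refine mul_le_mul_of_nonneg_left (sub_le_sub_right ?_ _) hγ
        exact rSquared_mono X y Finset.subset_union_right
    _ ≤ minEig (principalSub (covMatrix X) (A ∪ T)) *
          (rSquared X y (A ∪ T) - rSquared X y A) :=
        mul_le_mul_of_nonneg_right (sparseMinEig_le_minEig X hne' hcard) hD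
    _ ≤ ∑ j ∈ T \ A, inner ℝ (y - fitted X y A) (featureCol X j) ^ 2 :=
        minEig_mul_rSquared_union_sub_le X y A T
    _ ≤ (T \ A).card • g := Finset.sum_le_card_nsmul _ _ _ hgain
    _ = ((T \ A).card : ℝ) * g := nsmul_eq_mul _ _
    _ ≤ k * g := by
        refine mul_le_mul_of_nonneg_right ?_ hstep
        exact_mod_cast (Finset.card_le_card Finset.sdiff_subset).trans hT

/-- Each step shrinks the gap to f(T) by the factor 1 - γ/k, and (1 - γ/k)^k ≤ e^{-γ}. -/
theorem rSquared_greedy_ge (hX : ∀ j, ‖featureCol X j‖ = 1) {k : ℕ}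
    {S T : Finset (Fin d)} (hTS : T ⊆ S) (hT : T.card ≤ k) :
    (1 - Real.exp (-sparseMinEig (covMatrix X) (2 * k))) * rSquared X y T ≤
      rSquared X y (greedy (rSquared X y) τ S k) := by
  rcases T.eq_empty_or_nonempty with rfl | hne
  · rw [rSquared_empty, mul_zero]
    exact rSquared_nonneg X y _
  have hk : 1 ≤ k := hne.card_pos.trans_le hT
  have hk' : (0 : ℝ) < k := by exact_mod_cast hk
  set γ := sparseMinEig (covMatrix X) (2 * k) with hγdef
  -- Needed to keep the contraction factor 1 - γ/k nonnegative.
  have hγ1 : γ ≤ 1 :=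
    (sparseMinEig_le_minEig X hne (by omega)).trans (minEig_le_one X hX hne)
  have hγk : γ ≤ k := hγ1.trans (by exact_mod_cast hk)
  have hρ : 0 ≤ 1 - γ / k := sub_nonneg.2 ((div_le_one hk').2 hγk)
  have main : ∀ i ≤ k, rSquared X y T - rSquared X y (greedy (rSquared X y) τ S i) ≤
      (1 - γ / k) ^ i * rSquared X y T := by
    intro i
    induction i with
    | zero => intro _; simp [greedy, rSquared_empty]
    | succ i ih =>
      intro hi
      have h1 := sparseMinEig_mul_sub_le_mul_gain X y τ hX hTS hT
        ((card_greedy_le (f := rSquared X y) (τ := τ) S i).trans (by omega))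
      rw [← greedy_succ, ← hγdef, mul_comm (k : ℝ), ← div_le_iff₀ hk', mul_div_right_comm] at h1
      have h2 := mul_le_mul_of_nonneg_left (ih (by omega)) hρ
      rw [pow_succ']
      linarith
  have h1 := main k le_rfl
  have h2 := mul_le_mul_of_nonneg_right (Real.one_sub_div_pow_le_exp_neg hγk)
    (rSquared_nonneg X y T)
  linarith

end GreedyRSquared

/-! ### Random partitions and local solutions -/

section Distributed

/-- Resampling the machine of `o`: over uniform `φ` and `j`, the event that `o` is picked after
being added to part `j` is as likely as the event that `o` is picked by its own machine. -/
theorem sum_insert_part_eq {d l : ℕ} (o : Fin d) (F : Finset (Fin d) → ℝ) :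
    ∑ p : (Fin d → Fin l) × Fin l, F (insert o (part p.1 p.2)) =
      ∑ p : (Fin d → Fin l) × Fin l, F (part p.1 (p.1 o)) := by
  -- Swap j with the machine of o: after the swap, the part containing o is the old part j with o
  -- inserted.
  have hinv : Function.Involutive fun p : (Fin d → Fin l) × Fin l =>
      ((Function.update p.1 o p.2, p.1 o) : (Fin d → Fin l) × Fin l) := by
    rintro ⟨φ, j⟩
    simp
  refine Fintype.sum_equiv hinv.toPerm _ _ ?_
  rintro ⟨φ, j⟩
  congr 1
  ext i
  by_cases hi : i = o
  · simp [part, hi]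
  · simp [part, hi]

variable {n d k l : ℕ} (X : Matrix (Fin n) (Fin d) ℝ) (y : EuclideanSpace ℝ (Fin n))
  (τ : Equiv.Perm (Fin d))

theorem rSquared_localSolution_ge (hX : ∀ j, ‖featureCol X j‖ = 1) (φ : Fin d → Fin l)
    (j : Fin l) {T : Finset (Fin d)} (hT : T.card ≤ k)
    (hTφ : ∀ o ∈ T, o ∉ greedy (rSquared X y) τ (insert o (part φ j)) k) :
    (1 - Real.exp (-sparseMinEig (covMatrix X) (2 * k))) * rSquared X y T ≤
      rSquared X y (localSolution (rSquared X y) τ k φ j) := by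
  have h := (greedy_eq_of_forall_notMem (f := rSquared X y) (τ := τ)
    (Finset.subset_union_left (s₁ := part φ j) (s₂ := T)) k fun o ho => hTφ o (by
      rw [Finset.mem_sdiff, Finset.mem_union] at ho
      tauto)).1
  rw [localSolution, ← h]
  exact rSquared_greedy_ge X y τ hX Finset.subset_union_right hT

end Distributed

/-! ### Averaging over partitions -/

section Expectation

variable {n d k l : ℕ} (X : Matrix (Fin n) (Fin d) ℝ) (y : EuclideanSpace ℝ (Fin n))
  (τ : Equiv.Perm (Fin d))

theorem one_sub_exp_neg_sparseMinEig_nonneg (k : ℕ) :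
    0 ≤ 1 - Real.exp (-sparseMinEig (covMatrix X) k) := by
  have := Real.exp_le_one_iff.2 (neg_nonpos.2 (sparseMinEig_nonneg X k))
  linarith

/-- The deterministic bound for one partition and one machine. -/
theorem sum_indicator_le_rSquared_output (hX : ∀ j, ‖featureCol X j‖ = 1)
    {φ : Fin d → Fin l} {A Astar : Finset (Fin d)}
    (hA : IsDistributedGreedyOutput (rSquared X y) τ k φ A) (hcard : Astar.card ≤ k)
    (hne : Astar.Nonempty) (j : Fin l) :
    (1 - Real.exp (-sparseMinEig (covMatrix X) (2 * k))) *
        ∑ o ∈ Astar, inner ℝ y (featureCol X o) ^ 2 *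
          ((if o ∈ greedy (rSquared X y) τ (part φ (φ o)) k then 1 else 0) +
            (1 - if o ∈ greedy (rSquared X y) τ (insert o (part φ j)) k then 1 else 0)) ≤
      2 * maxEig (principalSub (covMatrix X) Astar) * rSquared X y A := by
  set κ := 1 - Real.exp (-sparseMinEig (covMatrix X) (2 * k))
  set L := maxEig (principalSub (covMatrix X) Astar)
  have hκ : 0 ≤ κ := one_sub_exp_neg_sparseMinEig_nonneg X (2 * k)
  have hL : 0 ≤ L := zero_le_one.trans (one_le_maxEig X hX hne)
  set T₁ := Astar.filter fun o => o ∈ greedy (rSquared X y) τ (part φ (φ o)) k with hT₁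
  set T₂ := Astar.filter fun o => o ∉ greedy (rSquared X y) τ (insert o (part φ j)) k with hT₂
  have hs₁ : T₁ ⊆ Astar := Finset.filter_subset _ _
  have hs₂ : T₂ ⊆ Astar := Finset.filter_subset _ _
  have h₁ : κ * rSquared X y T₁ ≤ rSquared X y A := by
    refine le_trans ?_ hA.2.1
    refine rSquared_greedy_ge X y τ hX (fun o ho => ?_) ((Finset.card_le_card hs₁).trans hcard)
    exact Finset.mem_biUnion.2 ⟨φ o, Finset.mem_univ _, (Finset.mem_filter.1 ho).2⟩
  have h₂ : κ * rSquared X y T₂ ≤ rSquared X y A :=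
    (rSquared_localSolution_ge X y τ hX φ j ((Finset.card_le_card hs₂).trans hcard)
      fun o ho => (Finset.mem_filter.1 ho).2).trans (hA.2.2 j)
  have hsum : ∑ o ∈ Astar, inner ℝ y (featureCol X o) ^ 2 *
      ((if o ∈ greedy (rSquared X y) τ (part φ (φ o)) k then (1 : ℝ) else 0) +
        (1 - if o ∈ greedy (rSquared X y) τ (insert o (part φ j)) k then 1 else 0)) =
      ∑ o ∈ T₁, inner ℝ y (featureCol X o) ^ 2 + ∑ o ∈ T₂, inner ℝ y (featureCol X o) ^ 2 := by
    rw [hT₁, hT₂, Finset.sum_filter, Finset.sum_filter, ← Finset.sum_add_distrib]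
    refine Finset.sum_congr rfl fun o _ => ?_
    split_ifs <;> ring
  rw [hsum]
  have e₁ := sum_inner_sq_le_maxEig_mul_rSquared X y hs₁
  have e₂ := sum_inner_sq_le_maxEig_mul_rSquared X y hs₂
  calc κ * _ ≤ κ * (L * rSquared X y T₁ + L * rSquared X y T₂) :=
        mul_le_mul_of_nonneg_left (add_le_add e₁ e₂) hκ
    _ = L * (κ * rSquared X y T₁ + κ * rSquared X y T₂) := by ring
    _ ≤ L * (rSquared X y A + rSquared X y A) :=
        mul_le_mul_of_nonneg_left (add_le_add h₁ h₂) hL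
    _ = 2 * L * rSquared X y A := by ring

theorem sum_inner_sq_le_expect_rSquared_output (hl : 0 < l) (hX : ∀ j, ‖featureCol X j‖ = 1)
    {Adg : (Fin d → Fin l) → Finset (Fin d)}
    (hAdg : ∀ φ, IsDistributedGreedyOutput (rSquared X y) τ k φ (Adg φ))
    {Astar : Finset (Fin d)} (hcard : Astar.card ≤ k) (hne : Astar.Nonempty) :
    (1 - Real.exp (-sparseMinEig (covMatrix X) (2 * k))) *
        ∑ o ∈ Astar, inner ℝ y (featureCol X o) ^ 2 ≤
      2 * maxEig (principalSub (covMatrix X) Astar) *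
        𝔼 φ : Fin d → Fin l, rSquared X y (Adg φ) := by
  have : Nonempty (Fin l) := ⟨⟨0, hl⟩⟩
  -- The machine j is an auxiliary uniform variable, independent of φ.
  have h := Finset.sum_le_sum fun (p : (Fin d → Fin l) × Fin l) (_ : p ∈ Finset.univ) =>
    sum_indicator_le_rSquared_output X y τ hX (hAdg p.1) hcard hne p.2
  rw [← Finset.mul_sum, ← Finset.mul_sum, Finset.sum_comm] at h
  have hinner : ∀ o ∈ Astar, ∑ p : (Fin d → Fin l) × Fin l, inner ℝ y (featureCol X o) ^ 2 *
      ((if o ∈ greedy (rSquared X y) τ (part p.1 (p.1 o)) k then (1 : ℝ) else 0) +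
        (1 - if o ∈ greedy (rSquared X y) τ (insert o (part p.1 p.2)) k then 1 else 0)) =
      (Fintype.card (Fin d → Fin l) * l : ℝ) * inner ℝ y (featureCol X o) ^ 2 := by
    intro o _
    rw [← Finset.mul_sum, Finset.sum_add_distrib, Finset.sum_sub_distrib,
      sum_insert_part_eq o fun S => if o ∈ greedy (rSquared X y) τ S k then (1 : ℝ) else 0,
      add_sub_cancel, Finset.sum_const, Finset.card_univ, Fintype.card_prod, nsmul_eq_mul,
      Fintype.card_fin]
    push_cast
    ring
  rw [Finset.sum_congr rfl hinner, ← Finset.mul_sum, Fintype.sum_prod_type] at h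
  simp only [Finset.sum_const, Finset.card_univ, Fintype.card_fin, nsmul_eq_mul] at h
  rw [← Finset.mul_sum, ← Fintype.card_mul_expect] at h
  have hpos : (0 : ℝ) < Fintype.card (Fin d → Fin l) * l :=
    mul_pos (by exact_mod_cast Fintype.card_pos) (by exact_mod_cast hl)
  refine le_of_mul_le_mul_left ?_ hpos
  refine le_trans (le_of_eq ?_) (h.trans (le_of_eq ?_)) <;> ring

theorem sparse_ratio_le_ratio (hX : ∀ j, ‖featureCol X j‖ = 1) {S : Finset (Fin d)}
    (hne : S.Nonempty) (hcard : S.card ≤ k) :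
    sparseMinEig (covMatrix X) k / sparseMaxEig (covMatrix X) k ≤
      minEig (principalSub (covMatrix X) S) / maxEig (principalSub (covMatrix X) S) :=
  div_le_div₀ (minEig_nonneg (posSemidef_principalSub_covMatrix X S))
    (sparseMinEig_le_minEig X hne hcard) (zero_lt_one.trans_le (one_le_maxEig X hX hne))
    (maxEig_le_sparseMaxEig X hne hcard)

end Expectation

/-- The expectation is over a uniformly random assignment `φ` of the `d` features to the `l`
machines, and `Adg φ` is the set that `DistributedGreedy` returns on the resulting partition. -/
theorem mainTheorem3 {n d : ℕ} (k l : ℕ) (hl : 0 < l)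
    (X : Matrix (Fin n) (Fin d) ℝ) (y : EuclideanSpace ℝ (Fin n))
    (hX : ∀ j, ‖featureCol X j‖ = 1) (hy : ‖y‖ = 1)
    (τ : Equiv.Perm (Fin d))
    (Adg : (Fin d → Fin l) → Finset (Fin d))
    (hAdg : ∀ φ, IsDistributedGreedyOutput (rSquared X y) τ k φ (Adg φ))
    (Astar : Finset (Fin d)) (hAstar : IsOptimalSupport (rSquared X y) k Astar) :
    (𝔼 φ : Fin d → Fin l, rSquared X y (Adg φ)) ≥
        1 / 2 * (minEig (principalSub (covMatrix X) Astar) /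
            maxEig (principalSub (covMatrix X) Astar)) *
          (1 - Real.exp (-sparseMinEig (covMatrix X) (2 * k))) * rSquared X y Astar ∧
      1 / 2 * (minEig (principalSub (covMatrix X) Astar) /
            maxEig (principalSub (covMatrix X) Astar)) *
          (1 - Real.exp (-sparseMinEig (covMatrix X) (2 * k))) * rSquared X y Astar ≥
        1 / 2 * (sparseMinEig (covMatrix X) k / sparseMaxEig (covMatrix X) k) *
          (1 - Real.exp (-sparseMinEig (covMatrix X) (2 * k))) * rSquared X y Astar := by
  rcases Astar.eq_empty_or_nonempty with rfl | hne
  · rw [rSquared_empty, mul_zero, mul_zero]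
    exact ⟨Finset.expect_nonneg fun φ _ => rSquared_nonneg X y _, le_rfl⟩
  have hκ := one_sub_exp_neg_sparseMinEig_nonneg X (2 * k)
  have hf := rSquared_nonneg X y Astar
  have hL := zero_lt_one.trans_le (one_le_maxEig X hX hne)
  refine ⟨?_, ?_⟩
  · have h1 := sum_inner_sq_le_expect_rSquared_output X y τ hl hX hAdg hAstar.1 hne
    have h2 := mul_le_mul_of_nonneg_left (minEig_mul_rSquared_le X y Astar) hκ
    refine le_of_mul_le_mul_left (le_trans (le_of_eq ?_) (h2.trans h1)) (mul_pos two_pos hL)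
    field_simp
  · have h := sparse_ratio_le_ratio X hX hne hAstar.1
    refine mul_le_mul_of_nonneg_right (mul_le_mul_of_nonneg_right ?_ hκ) hf
    exact mul_le_mul_of_nonneg_left h (by norm_num)
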